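/- Let $D\subset\mathbb C^n$ be a domain (a non-empty connected open set; no smoothness or boundedness of $D$ is assumed). Suppose that for every boundary point $a\in\partial D$ there are an open neighborhood $U_a$ of $a$ and a plurisubharmonic function $u_a:D\cap U_a\to[-\infty,\infty)$ such that $\lim_{D\cap U_a\ni z\to a}u_a(z)=\infty$. Then $D$ is pseudoconvex, i.e. there is a continuous plurisubharmonic function $u:D\to\mathbb R$ such that $\{z\in D: u(z)\le c\}$ is compact for every $c\in\mathbb R$. In particular, every locally weakly linearly convex domain $D\subset\mathbb C^n$ is pseudoconvex. Here $D$ is called locally weakly linearly convex if for every boundary point $a\in\partial D$ there are a complex (affine) hyperplane $H_a$ through $a$ and a neighborhood $U_a$ of $a$ such that $H_a\cap D\cap U_a=\varnothing$. -/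

import Mathlib

open Set Filter Topology MeasureTheory

noncomputable section

/-- The mean `(1/2π) ∫₀^{2π} v(c + r e^{iθ}) dθ`, with values in `[-∞, ∞]`, of an extended real
valued function, as the integral of the positive part minus the integral of the negative part.
It is only used for functions that are bounded above on the circle, for which the integral of the
positive part is finite. -/
def extCircleMean (v : ℂ → EReal) (c : ℂ) (r : ℝ) : EReal :=
  (((2 * Real.pi)⁻¹ : ℝ) : EReal) *
    (((∫⁻ θ in Ioc (0 : ℝ) (2 * Real.pi), (v (circleMap c r θ)).toENNReal : ENNReal) : EReal) -
      ((∫⁻ θ in Ioc (0 : ℝ) (2 * Real.pi), (-v (circleMap c r θ)).toENNReal : ENNReal) : EReal))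

/-- `v : G → [-∞, ∞)` is subharmonic on the (open) set `G ⊆ ℂ`: it is upper semicontinuous and
satisfies the sub-mean value inequality on every closed disc contained in `G`.
The function that is constantly `-∞` is allowed. -/
structure IsSubharmonicOn (v : ℂ → EReal) (G : Set ℂ) : Prop where
  upperSemicontinuousOn : UpperSemicontinuousOn v G
  lt_top : ∀ ζ ∈ G, v ζ < ⊤
  submean : ∀ (c : ℂ) (r : ℝ), 0 < r → Metric.closedBall c r ⊆ G → v c ≤ extCircleMean v c r

/-- `u : Ω → [-∞, ∞)` is plurisubharmonic on the (open) set `Ω ⊆ ℂⁿ`: it is upper semicontinuous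
and its restriction to every complex line is subharmonic. -/
structure IsPlurisubharmonicOn {n : ℕ} (u : EuclideanSpace ℂ (Fin n) → EReal)
    (Ω : Set (EuclideanSpace ℂ (Fin n))) : Prop where
  upperSemicontinuousOn : UpperSemicontinuousOn u Ω
  lt_top : ∀ z ∈ Ω, u z < ⊤
  subharmonic_line : ∀ z w : EuclideanSpace ℂ (Fin n),
    IsSubharmonicOn (fun ζ : ℂ => u (z + ζ • w)) {ζ : ℂ | z + ζ • w ∈ Ω}

/-- An (open) set `D ⊆ ℂⁿ` is pseudoconvex: there is a continuous plurisubharmonic function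
`u : D → ℝ` all of whose sublevel sets `{z ∈ D | u z ≤ c}` are compact. -/
def IsPseudoconvex {n : ℕ} (D : Set (EuclideanSpace ℂ (Fin n))) : Prop :=
  ∃ u : EuclideanSpace ℂ (Fin n) → ℝ,
    ContinuousOn u D ∧ IsPlurisubharmonicOn (fun z => (u z : EReal)) D ∧
      ∀ c : ℝ, IsCompact {z | z ∈ D ∧ u z ≤ c}

/-- `D ⊆ ℂⁿ` is locally weakly linearly convex: for every boundary point `a` there are a complex
hyperplane `H = {z | ℓ (z - a) = 0}` through `a` and a neighborhood `U` of `a` such that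
`H ∩ D ∩ U = ∅`. -/
def IsLocallyWeaklyLinearlyConvex {n : ℕ} (D : Set (EuclideanSpace ℂ (Fin n))) : Prop :=
  ∀ a ∈ frontier D, ∃ ℓ : EuclideanSpace ℂ (Fin n) →ₗ[ℂ] ℂ, ℓ ≠ 0 ∧
    ∃ U ∈ 𝓝 a, {z | ℓ (z - a) = 0} ∩ D ∩ U = ∅

end

/-! The function `max (-log d) ‖z‖`, with `d` the distance to the complement, exhausts `D`, so
everything rests on the sub-mean value property of `-log d` along complex lines. If it fails on a
disc, `-log d` is touched from above at some `ζ₀` by `Re Q - ε|ζ - ζ₀|²` plus a constant, with `Q`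
entire (`exists_touching_of_circleAverage_lt`). Let `a` be a point of the complement nearest to the
point over `ζ₀`. Pushing the disc by `t e^{-Q}` times the vector from that point to `a` gives
analytic discs that stay in `D` for `t < 1` and, at `t = 1`, leave `D` only at `a`. Near `a` their
boundary circles sweep out a compact subset of `D ∩ U`, so `u` is bounded there, while `u` blows up
at the centres as `t → 1`: this contradicts the maximum principle
(`IsPlurisubharmonicOn.not_lt_on_disc`).

These discs are curved, but plurisubharmonicity is only given on lines. A truncation of `u` is
therefore smoothed by convolution; for the resulting `C¹` function a curved disc can be replaced by
its tangent line up to a term of mean zero and a negligible error (`not_touching_of_submean`).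

For weak linear convexity, `-log |ℓ(z - a)|` serves as the local function. -/

/-! ### Touching functions on discs -/

open ComplexConjugate in
/-- A continuous real function on a circle is uniformly approximated by real parts of entire
functions. -/
theorem exists_differentiable_re_approx {f : ℂ → ℝ} {c : ℂ} {r : ℝ} (hr : 0 < r)
    (hf : ContinuousOn f (Metric.sphere c r)) {ε : ℝ} (hε : 0 < ε) :
    ∃ P : ℂ → ℂ, Differentiable ℂ P ∧ ∀ z ∈ Metric.sphere c r, |f z - (P z).re| < ε := by
  have hπ : Fact (0 < 2 * Real.pi) := ⟨by positivity⟩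
  have hmem : ∀ x : Circle, c + r * (x : ℂ) ∈ Metric.sphere c r := by
    intro x; simp [abs_of_pos hr, Circle.norm_coe]
  have hcont : Continuous fun x : AddCircle (2 * Real.pi) =>
      ((f (c + r * (AddCircle.toCircle x : ℂ)) : ℝ) : ℂ) := by
    refine Complex.continuous_ofReal.comp (hf.comp_continuous ?_ fun x => hmem _)
    have := AddCircle.continuous_toCircle (T := 2 * Real.pi)
    fun_prop
  let g : C(AddCircle (2 * Real.pi), ℂ) := ⟨_, hcont⟩
  have hg : g ∈ (Submodule.span ℂ (range (fourier (T := 2 * Real.pi)))).topologicalClosure := by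
    rw [span_fourier_closure_eq_top]; trivial
  obtain ⟨T, hT, hgT⟩ := Metric.mem_closure_iff.1 hg ε hε
  -- On the circle, a character of index `m ≥ 0` is `((z - c) / r) ^ m`, and one of index `-m` is
  -- its conjugate.
  have key : ∀ T ∈ Submodule.span ℂ (range (fourier (T := 2 * Real.pi))), ∃ P Q : ℂ → ℂ,
      Differentiable ℂ P ∧ Differentiable ℂ Q ∧ ∀ x, T x =
        P (c + r * (AddCircle.toCircle x : ℂ)) + conj (Q (c + r * (AddCircle.toCircle x : ℂ))) := by
    intro T hT
    induction hT using Submodule.span_induction with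
    | zero => exact ⟨fun _ => 0, fun _ => 0, by fun_prop, by fun_prop, by simp⟩
    | add S T _ _ hS hT =>
      obtain ⟨P, Q, hP, hQ, h⟩ := hS
      obtain ⟨P', Q', hP', hQ', h'⟩ := hT
      refine ⟨fun z => P z + P' z, fun z => Q z + Q' z, by fun_prop, by fun_prop, fun x => ?_⟩
      simp only [ContinuousMap.add_apply, h, h', map_add]
      ring
    | smul a S hS' hS =>
      obtain ⟨P, Q, hP, hQ, h⟩ := hS
      refine ⟨fun z => a * P z, fun z => conj a * Q z, by fun_prop, by fun_prop, fun x => ?_⟩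
      simp only [ContinuousMap.smul_apply, h, smul_eq_mul, map_mul, Complex.conj_conj]
      ring
    | mem S hS =>
      have hr' : (r : ℂ) ≠ 0 := by exact_mod_cast hr.ne'
      have hz : ∀ (m : ℕ) (x : AddCircle (2 * Real.pi)), fourier (m : ℤ) x =
          ((c + r * (AddCircle.toCircle x : ℂ) - c) / r) ^ m := by
        intro m x
        rw [fourier_apply, AddCircle.toCircle_zsmul, zpow_natCast, add_sub_cancel_left,
          mul_div_cancel_left₀ _ hr', Circle.coe_pow]
      obtain ⟨m, rfl⟩ := hS
      obtain ⟨m, rfl | rfl⟩ := m.eq_nat_or_neg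
      · refine ⟨fun z => ((z - c) / r) ^ m, fun _ => 0, by fun_prop, by fun_prop, fun x => ?_⟩
        simp only [hz, map_zero, add_zero]
      · refine ⟨fun _ => 0, fun z => ((z - c) / r) ^ m, by fun_prop, by fun_prop, fun x => ?_⟩
        simp only [fourier_neg, hz, zero_add]
  obtain ⟨P, Q, hP, hQ, h⟩ := key T hT
  refine ⟨fun z => P z + Q z, by fun_prop, fun z hz => ?_⟩
  obtain ⟨x, rfl⟩ : ∃ x : AddCircle (2 * Real.pi), z = c + r * (AddCircle.toCircle x : ℂ) := by
    have h1 : ‖(z - c) / r‖ = 1 := by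
      rw [norm_div, mem_sphere_iff_norm.1 hz, Complex.norm_real, Real.norm_of_nonneg hr.le,
        div_self hr.ne']
    obtain ⟨x, hx⟩ := (AddCircle.homeomorphCircle (T := 2 * Real.pi) (by positivity)).surjective
      (⟨(z - c) / r, by simpa [Submonoid.unitSphere] using h1⟩ : Circle)
    rw [AddCircle.homeomorphCircle_apply] at hx
    refine ⟨x, ?_⟩
    have hr' : (r : ℂ) ≠ 0 := by exact_mod_cast hr.ne'
    rw [hx]
    change z = c + r * ((z - c) / r)
    field_simp
    ring
  have h2 := (ContinuousMap.dist_lt_iff hε).1 hgT x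
  rw [dist_eq_norm] at h2
  have h3 := (Complex.abs_re_le_norm _).trans_lt h2
  rw [h] at h3
  simpa [g] using h3

/-- If a continuous function on a closed disc violates the sub-mean value inequality, it is touched
from above, at an interior point, by a strictly superharmonic quadratic perturbation of the real
part of an entire function. -/
theorem exists_touching_of_circleAverage_lt {f : ℂ → ℝ} {c : ℂ} {r : ℝ} (hr : 0 < r)
    (hf : ContinuousOn f (Metric.closedBall c r)) (hlt : Real.circleAverage f c r < f c) :
    ∃ ζ₀ ∈ Metric.ball c r, ∃ Q : ℂ → ℂ, Differentiable ℂ Q ∧ Q ζ₀ = 0 ∧ ∃ ε > 0,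
      ∀ ζ ∈ Metric.closedBall c r, f ζ ≤ f ζ₀ + (Q ζ).re - ε * ‖ζ - ζ₀‖ ^ 2 := by
  -- The gap is `4η`. Replacing `f` by `Re P` costs `η` on the circle and `η` at the centre, the
  -- quadratic term `η` on the circle; the value at the centre still wins, so the maximum is
  -- interior.
  set η := (f c - Real.circleAverage f c r) / 4 with hη
  have hη0 : 0 < η := by rw [hη]; linarith
  have hfs := hf.mono Metric.sphere_subset_closedBall
  obtain ⟨P, hP, hPf⟩ := exists_differentiable_re_approx hr hfs hη0
  have hPc : (P c).re ≤ Real.circleAverage f c r + η := by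
    have h1 : Real.circleAverage P c r = P c := hP.diffContOnCl.circleAverage
    have hPi : CircleIntegrable P c r := hP.continuous.continuousOn.circleIntegrable hr.le
    have h2 := Complex.reCLM.circleAverage_comp_comm hPi
    rw [h1] at h2
    have h3 : Real.circleAverage (fun z => f z + η) c r = Real.circleAverage f c r + η := by
      have := Real.circleAverage_fun_add (f₁ := f) (f₂ := fun _ => η) (c := c) (R := r)
        (hfs.circleIntegrable hr.le) (continuousOn_const.circleIntegrable hr.le)
      rw [this, Real.circleAverage_const]
    rw [← h3, ← Complex.reCLM_apply, ← h2]
    refine Real.circleAverage_mono ?_ ?_ ?_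
    · exact (Complex.reCLM.continuous.comp hP.continuous).continuousOn.circleIntegrable hr.le
    · exact (hfs.add continuousOn_const).circleIntegrable hr.le
    · intro x hx
      rw [abs_of_pos hr] at hx
      have := (abs_lt.1 (hPf x hx)).1
      simp only [Function.comp_apply, Complex.reCLM_apply]
      linarith
  set ε := η / r ^ 2 with hε
  have hε0 : 0 < ε := by positivity
  obtain ⟨ζ₀, hζ₀, hmax⟩ := (isCompact_closedBall c r).exists_isMaxOn
    (Metric.nonempty_closedBall.2 hr.le)
    (f := fun ζ => f ζ - (P ζ).re + ε * ‖ζ - c‖ ^ 2) (by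
      have := hP.continuous
      exact (hf.sub (by fun_prop)).add (by fun_prop))
  have hball : ζ₀ ∈ Metric.ball c r := by
    rcases (Metric.mem_closedBall.1 hζ₀).lt_or_eq with h | h
    · exact h
    · exfalso
      have h1 := hmax (Metric.mem_closedBall_self hr.le)
      have h2 := (abs_lt.1 (hPf ζ₀ h)).2
      have h3 : ‖ζ₀ - c‖ = r := by rw [← dist_eq_norm, h]
      have h4 : ε * r ^ 2 = η := by rw [hε]; field_simp
      simp only [mem_ofPred_eq, sub_self, norm_zero, h3, h4] at h1
      have h5 : f c - Real.circleAverage f c r = 4 * η := by rw [hη]; ring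
      have h6 : ε * (0 : ℝ) ^ 2 = 0 := by ring
      rw [h6] at h1
      linarith
  -- Expanding `‖ζ - c‖²` about `ζ₀` leaves `‖ζ - ζ₀‖²` and a cross term, which is the real part of
  -- an affine function and is absorbed into `Q`.
  refine ⟨ζ₀, hball, fun ζ => P ζ - P ζ₀ - 2 * ε * (starRingEnd ℂ (ζ₀ - c) * (ζ - ζ₀)),
    by fun_prop, by simp, ε, hε0, fun ζ hζ => ?_⟩
  have h1 := hmax hζ
  simp only [mem_ofPred_eq] at h1
  have h2 : ‖ζ - c‖ ^ 2 = ‖ζ₀ - c‖ ^ 2 + 2 * (starRingEnd ℂ (ζ₀ - c) * (ζ - ζ₀)).re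
      + ‖ζ - ζ₀‖ ^ 2 := by
    simp only [← Complex.normSq_eq_norm_sq, Complex.normSq_apply, Complex.mul_re, Complex.conj_re,
      Complex.conj_im, Complex.sub_re, Complex.sub_im]
    ring
  have h3 : (2 * (ε : ℂ) * (starRingEnd ℂ (ζ₀ - c) * (ζ - ζ₀))).re =
      2 * ε * (starRingEnd ℂ (ζ₀ - c) * (ζ - ζ₀)).re := by
    rw [show (2 * (ε : ℂ)) = ((2 * ε : ℝ) : ℂ) by push_cast; rfl, Complex.re_ofReal_mul]
  rw [h2] at h1
  rw [Complex.sub_re, Complex.sub_re, h3]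
  nlinarith

/-- Second order Taylor estimate for entire curves. -/
theorem exists_taylor_two_bound {E : Type*} [NormedAddCommGroup E] [NormedSpace ℂ E]
    [CompleteSpace E] {ψ : ℂ → E} (hψ : Differentiable ℂ ψ) (ζ₀ : ℂ) :
    ∃ C > 0, ∀ᶠ ζ in 𝓝 ζ₀, ‖ψ ζ - (ψ ζ₀ + (ζ - ζ₀) • deriv ψ ζ₀)‖ ≤ C * ‖ζ - ζ₀‖ ^ 2 := by
  have hd : DifferentiableAt ℂ (dslope ψ ζ₀) ζ₀ :=
    ((Complex.differentiableOn_dslope univ_mem).2 hψ.differentiableOn).differentiableAt univ_mem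
  obtain ⟨C, hC, hO⟩ := hd.isBigO_sub.exists_pos
  refine ⟨C, hC, hO.bound.mono fun ζ hζ => ?_⟩
  have h1 : ψ ζ - (ψ ζ₀ + (ζ - ζ₀) • deriv ψ ζ₀) =
      (ζ - ζ₀) • (dslope ψ ζ₀ ζ - dslope ψ ζ₀ ζ₀) := by
    rw [smul_sub, sub_smul_dslope, dslope_same]
    abel
  rw [h1, norm_smul]
  calc ‖ζ - ζ₀‖ * _ ≤ ‖ζ - ζ₀‖ * (C * ‖ζ - ζ₀‖) := by gcongr
    _ = _ := by ring

/-- A `C¹` function which satisfies the sub-mean value inequality along the complex tangent of an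
entire curve is not touched from above along this curve by a strictly superharmonic function. -/
theorem not_touching_of_submean {E : Type*} [NormedAddCommGroup E] [NormedSpace ℂ E]
    [CompleteSpace E] {h : E → ℝ} {Q : ℂ → ℂ} {ψ : ℂ → E} (hψ : Differentiable ℂ ψ)
    {ζ₀ : ℂ} {L : E →L[ℝ] ℝ} (hh : HasStrictFDerivAt h L (ψ ζ₀)) (hc : Continuous h)
    (hQ : Differentiable ℂ Q) (hQ0 : Q ζ₀ = 0) {ε : ℝ} (hε : 0 < ε)
    (htouch : ∀ᶠ ζ in 𝓝 ζ₀, h (ψ ζ) ≤ h (ψ ζ₀) + (Q ζ).re - ε * ‖ζ - ζ₀‖ ^ 2)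
    (hsub : ∀ᶠ r in 𝓝[>] (0 : ℝ),
      h (ψ ζ₀) ≤ Real.circleAverage (fun ζ => h (ψ ζ₀ + (ζ - ζ₀) • deriv ψ ζ₀)) ζ₀ r) : False := by
  obtain ⟨C, hC, hR⟩ := exists_taylor_two_bound hψ ζ₀
  set A := deriv ψ ζ₀
  have hlin : Differentiable ℂ fun ζ => ψ ζ₀ + (ζ - ζ₀) • A := by fun_prop
  set R : ℂ → E := fun ζ => ψ ζ - (ψ ζ₀ + (ζ - ζ₀) • A) with hRdef
  have hRd : Differentiable ℂ R := hψ.sub hlin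
  -- Both compared points move with `ζ`. Strict differentiability makes the error `o(‖R ζ‖)`, hence
  -- `o(‖ζ - ζ₀‖²)`; the factor `ε / (2C)` lets it consume only half of `ε`.
  have hlim : Tendsto (fun ζ => (ψ ζ, ψ ζ₀ + (ζ - ζ₀) • A)) (𝓝 ζ₀) (𝓝 (ψ ζ₀, ψ ζ₀)) := by
    have h1 := (hψ.continuous.prodMk hlin.continuous).tendsto ζ₀
    simpa using h1
  have hκ : 0 < ε / (2 * C) := by positivity
  have hev : ∀ᶠ ζ in 𝓝 ζ₀, h (ψ ζ₀ + (ζ - ζ₀) • A) ≤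
      (h (ψ ζ₀) - ε / 2 * ‖ζ - ζ₀‖ ^ 2) + ((Q ζ).re - L (R ζ)) := by
    filter_upwards [htouch, hR, hlim.eventually (hh.isLittleO.bound hκ)] with ζ h1 h2 h3
    rw [Real.norm_eq_abs] at h3
    have h4 := (abs_le.1 h3).1
    have h5 : ε / (2 * C) * ‖R ζ‖ ≤ ε / 2 * ‖ζ - ζ₀‖ ^ 2 := by
      calc ε / (2 * C) * ‖R ζ‖ ≤ ε / (2 * C) * (C * ‖ζ - ζ₀‖ ^ 2) := by gcongr
        _ = _ := by field_simp
    change -(ε / (2 * C) * ‖R ζ‖) ≤ h (ψ ζ) - h (ψ ζ₀ + (ζ - ζ₀) • A) - L (R ζ) at h4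
    linarith
  obtain ⟨δ, hδ, hball⟩ := Metric.eventually_nhds_iff.1 hev
  obtain ⟨r, hr, hr0 : 0 < r, hrδ⟩ :=
    (hsub.and (eventually_mem_nhdsWithin.and
      ((eventually_lt_nhds hδ).filter_mono nhdsWithin_le_nhds))).exists
  have hQi : CircleIntegrable Q ζ₀ r := hQ.continuous.continuousOn.circleIntegrable hr0.le
  have hRi : CircleIntegrable R ζ₀ r := hRd.continuous.continuousOn.circleIntegrable hr0.le
  have hQa : Real.circleAverage (fun ζ => (Q ζ).re) ζ₀ r = 0 := by
    have h1 := Complex.reCLM.circleAverage_comp_comm hQi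
    rw [hQ.diffContOnCl.circleAverage, hQ0, map_zero] at h1
    exact h1
  -- `L` is only real linear, but it commutes with averages, and the entire map `R` has mean `R ζ₀ =
  -- 0`.
  have hRa : Real.circleAverage (fun ζ => L (R ζ)) ζ₀ r = 0 := by
    have h1 := L.circleAverage_comp_comm hRi
    rw [hRd.diffContOnCl.circleAverage] at h1
    have h2 : R ζ₀ = 0 := by simp [hRdef]
    rw [h2, map_zero] at h1
    exact h1
  have hi1 : Continuous fun ζ => (Q ζ).re := Complex.continuous_re.comp hQ.continuous
  have hi2 : Continuous fun ζ => L (R ζ) := L.continuous.comp hRd.continuous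
  have hi3 : Continuous fun ζ => (Q ζ).re - L (R ζ) := hi1.sub hi2
  have hle : Real.circleAverage (fun ζ => h (ψ ζ₀ + (ζ - ζ₀) • A)) ζ₀ r ≤
      Real.circleAverage (fun ζ => (h (ψ ζ₀) - ε / 2 * r ^ 2) + ((Q ζ).re - L (R ζ))) ζ₀ r := by
    refine Real.circleAverage_mono ?_ ?_ fun ζ hζ => ?_
    · exact (hc.comp hlin.continuous).continuousOn.circleIntegrable hr0.le
    · exact (continuous_const.add (hi1.sub hi2)).continuousOn.circleIntegrable hr0.le
    · rw [abs_of_pos hr0] at hζ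
      have h1 := hball (y := ζ) (by rw [Metric.mem_sphere.1 hζ]; exact hrδ)
      rwa [mem_sphere_iff_norm.1 hζ] at h1
  rw [Real.circleAverage_fun_add (continuous_const.continuousOn.circleIntegrable hr0.le)
    (hi3.continuousOn.circleIntegrable hr0.le), Real.circleAverage_const,
    Real.circleAverage_fun_sub (hi1.continuousOn.circleIntegrable hr0.le)
    (hi2.continuousOn.circleIntegrable hr0.le), hQa, hRa] at hle
  have : 0 < ε / 2 * r ^ 2 := by positivity
  linarith

/-! ### Extended circle means and plurisubharmonic functions -/

theorem extCircleMean_mono {v w : ℂ → EReal} {c : ℂ} {r : ℝ} (hr : 0 ≤ r)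
    (h : ∀ z ∈ Metric.sphere c r, v z ≤ w z) : extCircleMean v c r ≤ extCircleMean w c r := by
  have hvw : ∀ θ, v (circleMap c r θ) ≤ w (circleMap c r θ) :=
    fun θ => h _ (circleMap_mem_sphere c hr θ)
  refine mul_le_mul_of_nonneg_left (EReal.sub_le_sub ?_ ?_) (by exact_mod_cast by positivity)
  · exact_mod_cast lintegral_mono fun θ => EReal.toENNReal_le_toENNReal (hvw θ)
  · exact_mod_cast lintegral_mono fun θ =>
      EReal.toENNReal_le_toENNReal (EReal.neg_le_neg_iff.2 (hvw θ))

theorem extCircleMean_coe {f : ℂ → ℝ} {c : ℂ} {r : ℝ} (hf : CircleIntegrable f c r) :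
    extCircleMean (fun z => (f z : EReal)) c r = (Real.circleAverage f c r : ℝ) := by
  have hi : IntegrableOn (fun θ => f (circleMap c r θ)) (Ioc 0 (2 * Real.pi)) :=
    (intervalIntegrable_iff_integrableOn_Ioc_of_le Real.two_pi_pos.le).1 hf
  have h1 := hi.lintegral_lt_top.ne
  have h2 : ∫⁻ θ in Ioc 0 (2 * Real.pi), ENNReal.ofReal (-f (circleMap c r θ)) ≠ ⊤ :=
    hi.neg.lintegral_lt_top.ne
  rw [Real.circleAverage_def, intervalIntegral.integral_of_le Real.two_pi_pos.le,
    integral_eq_lintegral_pos_part_sub_lintegral_neg_part hi, smul_eq_mul, EReal.coe_mul,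
    EReal.coe_sub, EReal.coe_ennreal_toReal h1, EReal.coe_ennreal_toReal h2]
  rfl

/-- The sub-mean value inequality of a plurisubharmonic function on a disc in a complex line, for
a real majorant on the boundary circle. -/
theorem IsPlurisubharmonicOn.le_circleAverage {n : ℕ} {u : EuclideanSpace ℂ (Fin n) → EReal}
    {Ω : Set (EuclideanSpace ℂ (Fin n))} (hu : IsPlurisubharmonicOn u Ω)
    {z w : EuclideanSpace ℂ (Fin n)} {r : ℝ} (hr : 0 < r)
    (hΩ : ∀ ζ ∈ Metric.closedBall (0 : ℂ) r, z + ζ • w ∈ Ω) {g : EuclideanSpace ℂ (Fin n) → ℝ}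
    (hg : CircleIntegrable (fun ζ => g (z + ζ • w)) 0 r)
    (hug : ∀ ζ ∈ Metric.sphere (0 : ℂ) r, u (z + ζ • w) ≤ g (z + ζ • w)) :
    u z ≤ (Real.circleAverage (fun ζ => g (z + ζ • w)) 0 r : ℝ) := by
  have h1 := (hu.subharmonic_line z w).submean 0 r hr hΩ
  rw [zero_smul, add_zero] at h1
  rw [← extCircleMean_coe hg]
  exact h1.trans (extCircleMean_mono hr.le hug)

/-- A real continuous function with the sub-mean value property on complex discs is
plurisubharmonic. -/
theorem isPlurisubharmonicOn_coe {n : ℕ} {f : EuclideanSpace ℂ (Fin n) → ℝ}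
    {Ω : Set (EuclideanSpace ℂ (Fin n))} (hf : ContinuousOn f Ω)
    (hsub : ∀ (z w : EuclideanSpace ℂ (Fin n)) (c : ℂ) (r : ℝ), 0 < r →
      (∀ ζ ∈ Metric.closedBall c r, z + ζ • w ∈ Ω) →
      f (z + c • w) ≤ Real.circleAverage (fun ζ => f (z + ζ • w)) c r) :
    IsPlurisubharmonicOn (fun z => (f z : EReal)) Ω := by
  have hc : ContinuousOn (fun z => (f z : EReal)) Ω :=
    continuous_coe_real_ereal.comp_continuousOn hf
  have hl : ∀ z w : EuclideanSpace ℂ (Fin n), ContinuousOn (fun ζ : ℂ => f (z + ζ • w))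
      {ζ : ℂ | z + ζ • w ∈ Ω} := fun z w => hf.comp (by fun_prop) fun ζ hζ => hζ
  refine ⟨hc.upperSemicontinuousOn, fun z _ => EReal.coe_lt_top _, fun z w => ⟨?_, ?_, ?_⟩⟩
  · exact (continuous_coe_real_ereal.comp_continuousOn (hl z w)).upperSemicontinuousOn
  · exact fun ζ _ => EReal.coe_lt_top _
  · intro c r hr hcr
    have hi : CircleIntegrable (fun ζ => f (z + ζ • w)) c r :=
      ((hl z w).mono (Metric.sphere_subset_closedBall.trans hcr)).circleIntegrable hr.le
    have := extCircleMean_coe hi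
    rw [this]
    exact_mod_cast hsub z w c r hr hcr

/-! ### Regularization and the maximum principle on curved discs -/

open scoped Convolution in
/-- Regularization of a bounded measurable function which has the sub-mean value property on the
complex discs contained in a set `K`. -/
theorem exists_contDiff_regularization {E : Type*} [NormedAddCommGroup E] [NormedSpace ℂ E]
    [FiniteDimensional ℂ E] [MeasurableSpace E] [BorelSpace E] {g : E → ℝ} (hg : Measurable g)
    {B : ℝ} (hB : ∀ x, |g x| ≤ B) {K : Set E}
    (hsub : ∀ (z w : E) (r : ℝ), 0 < r → (∀ ζ ∈ Metric.closedBall (0 : ℂ) r, z + ζ • w ∈ K) →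
      g z ≤ Real.circleAverage (fun ζ => g (z + ζ • w)) 0 r) {δ : ℝ} (hδ : 0 < δ) :
    ∃ h : E → ℝ, ContDiff ℝ 1 h ∧
      (∀ x M, (∀ y ∈ Metric.ball x δ, g y ≤ M) → h x ≤ M) ∧
      (∀ x M, (∀ y ∈ Metric.ball x δ, M ≤ g y) → M ≤ h x) ∧
      ∀ (z w : E) (r : ℝ), 0 < r →
        (∀ ζ ∈ Metric.closedBall (0 : ℂ) r, ∀ y ∈ Metric.ball (0 : E) δ, z - y + ζ • w ∈ K) →
        h z ≤ Real.circleAverage (fun ζ => h (z + ζ • w)) 0 r := by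
  have : FiniteDimensional ℝ E := FiniteDimensional.complexToReal E
  let μ : Measure E := Measure.addHaar
  let b : ContDiffBump (0 : E) := ⟨δ / 2, δ, by positivity, by linarith⟩
  set χ : E → ℝ := b.normed μ with hχ
  have hχ0 : ∀ y, 0 ≤ χ y := fun y => b.nonneg_normed y
  have hχ1 : ∫ y, χ y ∂μ = 1 := b.integral_normed
  have hχi : Integrable χ μ := b.integrable_normed
  have hχs : ∀ y, y ∉ Metric.ball (0 : E) δ → χ y = 0 := by
    intro y hy
    rw [← Function.notMem_support, hχ, b.support_normed_eq]
    exact hy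
  have hgm : ∀ x, Measurable fun y => g (x - y) := fun x => hg.comp (by fun_prop)
  have hint : ∀ x, Integrable (fun y => χ y * g (x - y)) μ := fun x =>
    hχi.mul_bdd (c := B) (hgm x).aestronglyMeasurable (Eventually.of_forall fun y => hB _)
  have hloc : LocallyIntegrable g μ :=
    (locallyIntegrable_const B).mono hg.aestronglyMeasurable
      (Eventually.of_forall fun x => (hB x).trans (le_abs_self B))
  set h : E → ℝ := χ ⋆[ContinuousLinearMap.mul ℝ ℝ, μ] g with hh
  have hh' : ∀ x, h x = ∫ y, χ y * g (x - y) ∂μ := fun x => rfl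
  have hmono : ∀ F G : E → ℝ, Integrable (fun y => χ y * F y) μ → Integrable (fun y => χ y * G y) μ →
      (∀ y ∈ Metric.ball (0 : E) δ, F y ≤ G y) → ∫ y, χ y * F y ∂μ ≤ ∫ y, χ y * G y ∂μ := by
    intro F G hF hG hFG
    refine integral_mono hF hG fun y => ?_
    by_cases hy : y ∈ Metric.ball (0 : E) δ
    · exact mul_le_mul_of_nonneg_left (hFG y hy) (hχ0 y)
    · simp [hχs y hy]
  have hconst : ∀ M : ℝ, ∫ y, χ y * M ∂μ = M := fun M => by
    rw [integral_mul_const, hχ1, one_mul]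
  have hshift : ∀ x, ∀ y ∈ Metric.ball (0 : E) δ, x - y ∈ Metric.ball x δ := by
    intro x y hy
    simpa [dist_eq_norm] using hy
  refine ⟨h, b.hasCompactSupport_normed.contDiff_convolution_left _ b.contDiff_normed hloc,
    fun x M hM => ?_, fun x M hM => ?_, fun z w r hr hK => ?_⟩
  · rw [hh', ← hconst M]
    exact hmono _ _ (hint x) (hχi.mul_const M) fun y hy => hM _ (hshift x y hy)
  · rw [hh', ← hconst M]
    exact hmono _ _ (hχi.mul_const M) (hint x) fun y hy => hM _ (hshift x y hy)
  · let ν := (volume.restrict (Ioc (0 : ℝ) (2 * Real.pi)))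
    have hpm : Measurable fun p : ℝ × E => g (z + circleMap 0 r p.1 • w - p.2) := by
      refine hg.comp (Continuous.measurable ?_)
      have := continuous_circleMap 0 r
      fun_prop
    have hpi : Integrable (fun p : ℝ × E => χ p.2 * g (z + circleMap 0 r p.1 • w - p.2))
        (ν.prod μ) :=
      (hχi.comp_snd ν).mul_bdd (c := B) hpm.aestronglyMeasurable (Eventually.of_forall fun y => hB _)
    -- By Fubini the circle average passes under the convolution, where the inequality holds for
    -- each translate.
    have hswap : Real.circleAverage (fun ζ => h (z + ζ • w)) 0 r =
        ∫ y, χ y * Real.circleAverage (fun ζ => g (z - y + ζ • w)) 0 r ∂μ := by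
      rw [Real.circleAverage_def, intervalIntegral.integral_of_le Real.two_pi_pos.le]
      simp_rw [hh']
      rw [integral_integral_swap hpi, ← integral_smul]
      congr 1
      ext y
      rw [Real.circleAverage_def, intervalIntegral.integral_of_le Real.two_pi_pos.le,
        integral_const_mul, smul_eq_mul, smul_eq_mul]
      simp_rw [show ∀ θ, z + circleMap 0 r θ • w - y = z - y + circleMap 0 r θ • w by
        intro θ; abel]
      ring
    rw [hswap, hh']
    refine hmono _ _ (hint z) ?_ fun y hy => hsub _ w r hr fun ζ hζ => hK ζ hζ y hy
    have h1 := (hpi.swap.integral_prod_left).const_mul (2 * Real.pi)⁻¹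
    refine h1.congr (Eventually.of_forall fun y => ?_)
    simp only [Function.comp_apply, Prod.fst_swap, Prod.snd_swap]
    rw [Real.circleAverage_def, intervalIntegral.integral_of_le Real.two_pi_pos.le,
      integral_const_mul, smul_eq_mul]
    simp_rw [show ∀ θ, z + circleMap 0 r θ • w - y = z - y + circleMap 0 r θ • w by
        intro θ; abel]
    ring

/-- The maximum principle for a plurisubharmonic function on a (curved) analytic disc. -/
theorem IsPlurisubharmonicOn.not_lt_on_disc {n : ℕ} {u : EuclideanSpace ℂ (Fin n) → EReal}
    {Ω : Set (EuclideanSpace ℂ (Fin n))} (hΩ : IsOpen Ω) (hu : IsPlurisubharmonicOn u Ω)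
    {ψ : ℂ → EuclideanSpace ℂ (Fin n)} (hψ : Differentiable ℂ ψ) {c : ℂ} {r : ℝ} (hr : 0 < r)
    (hmaps : ∀ ζ ∈ Metric.closedBall c r, ψ ζ ∈ Ω) {M M' : ℝ} (hMM' : M < M')
    (hM : ∀ ζ ∈ Metric.sphere c r, u (ψ ζ) < M) (hM' : ∀ᶠ z in 𝓝 (ψ c), (M' : EReal) ≤ u z) :
    False := by
  classical
  set L := ψ '' Metric.closedBall c r with hLdef
  have hL : IsCompact L := (isCompact_closedBall c r).image hψ.continuous
  have hLΩ : L ⊆ Ω := image_subset_iff.2 hmaps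
  obtain ⟨ρ, hρ, hKΩ⟩ := hL.exists_cthickening_subset_open hΩ hLΩ
  set K := Metric.cthickening ρ L with hKdef
  have hK : IsCompact K := hL.cthickening
  have hLK : L ⊆ K := Metric.self_subset_cthickening L
  have hcL : ψ c ∈ L := mem_image_of_mem _ (Metric.mem_closedBall_self hr.le)
  obtain ⟨z₁, hz₁, hz₁max⟩ :=
    (hu.upperSemicontinuousOn.mono hKΩ).exists_isMaxOn ⟨_, hLK hcL⟩ hK
  -- Truncation at `M` gives a lower bound, and upper semicontinuity on the compact `K` an upper
  -- one. The value `M` off `K` is the minimum of `G`, so only upward jumps occur on `K` and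
  -- semicontinuity survives.
  set G : EuclideanSpace ℂ (Fin n) → EReal := fun z => if z ∈ K then max (u z) M else M with hG
  have hGK : ∀ z ∈ K, G z = max (u z) M := fun z hz => if_pos hz
  have hGM : ∀ z, (M : EReal) ≤ G z := by
    intro z
    by_cases hz : z ∈ K <;> simp [hG, hz]
  set T : EReal := max (u z₁) M with hT
  have hTtop : T ≠ ⊤ := (max_lt (hu.lt_top z₁ (hKΩ hz₁)) (EReal.coe_lt_top M)).ne
  have hGT : ∀ z, G z ≤ T := by
    intro z
    by_cases hz : z ∈ K
    · rw [hGK z hz]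
      exact max_le_max (hz₁max hz) le_rfl
    · simp [hG, hz, hT]
  have hGtop : ∀ z, G z ≠ ⊤ := fun z => ((hGT z).trans_lt hTtop.lt_top).ne
  have hGbot : ∀ z, G z ≠ ⊥ := fun z => ((EReal.bot_lt_coe M).trans_le (hGM z)).ne'
  have hGusc : UpperSemicontinuous G := by
    intro z t ht
    have hMt : (M : EReal) < t := (hGM z).trans_lt ht
    by_cases hz : z ∈ K
    · rw [hGK z hz] at ht
      have h1 := hu.upperSemicontinuousOn z (hKΩ hz) t ((le_max_left _ _).trans_lt ht)
      rw [hΩ.nhdsWithin_eq (hKΩ hz)] at h1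
      filter_upwards [h1] with y hy
      by_cases hyK : y ∈ K
      · rw [hGK y hyK]
        exact max_lt hy hMt
      · simpa [hG, hyK] using hMt
    · filter_upwards [hK.isClosed.isOpen_compl.mem_nhds hz] with y hy
      have hyK : y ∉ K := hy
      simpa [hG, hyK] using hMt
  set g : EuclideanSpace ℂ (Fin n) → ℝ := fun z => (G z).toReal with hg
  have hgG : ∀ z, (g z : EReal) = G z := fun z => EReal.coe_toReal (hGtop z) (hGbot z)
  have hgm : Measurable g := measurable_ereal_toReal.comp hGusc.measurable
  have hgM : ∀ z, M ≤ g z := fun z => by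
    have := hGM z
    rw [← hgG] at this
    exact_mod_cast this
  have hgB : ∀ z, |g z| ≤ max |M| |T.toReal| := fun z =>
    abs_le_max_abs_abs (hgM z) (EReal.toReal_le_toReal (hGT z) (hGbot z) hTtop)
  have hsub : ∀ (z w : EuclideanSpace ℂ (Fin n)) (s : ℝ), 0 < s →
      (∀ ζ ∈ Metric.closedBall (0 : ℂ) s, z + ζ • w ∈ K) →
      g z ≤ Real.circleAverage (fun ζ => g (z + ζ • w)) 0 s := by
    intro z w s hs hsK
    have hgi : CircleIntegrable (fun ζ => g (z + ζ • w)) 0 s := by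
      refine (intervalIntegrable_const (c := max |M| |T.toReal|)).mono_fun' ?_ ?_
      · refine (hgm.comp (Continuous.measurable ?_)).aestronglyMeasurable
        have := continuous_circleMap 0 s
        fun_prop
      · exact Eventually.of_forall fun θ => hgB _
    have hzK : z ∈ K := by
      simpa using hsK 0 (Metric.mem_closedBall_self hs.le)
    have h1 : G z ≤ (Real.circleAverage (fun ζ => g (z + ζ • w)) 0 s : ℝ) := by
      rw [hGK z hzK]
      refine max_le (hu.le_circleAverage hs (fun ζ hζ => hKΩ (hsK ζ hζ)) hgi fun ζ hζ => ?_) ?_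
      · rw [hgG, hGK _ (hsK ζ (Metric.sphere_subset_closedBall hζ))]
        exact le_max_left _ _
      · have h2 := Real.circleAverage_mono (c := 0) (R := s) (f₁ := fun _ => M)
          (continuousOn_const.circleIntegrable hs.le) hgi fun ζ _ => hgM _
        rw [Real.circleAverage_const] at h2
        exact_mod_cast h2
    rw [← hgG] at h1
    exact_mod_cast h1
  have hV : IsOpen {z | z ∈ Ω ∧ u z < M} := by
    rw [isOpen_iff_mem_nhds]
    rintro z ⟨hz, hzM⟩
    have h1 := hu.upperSemicontinuousOn z hz M hzM
    rw [hΩ.nhdsWithin_eq hz] at h1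
    filter_upwards [h1, hΩ.mem_nhds hz] with y hy hy' using ⟨hy', hy⟩
  obtain ⟨δ₁, hδ₁, hδ₁V⟩ := ((isCompact_sphere c r).image hψ.continuous).exists_thickening_subset_open
    hV (image_subset_iff.2 fun ζ hζ => ⟨hmaps ζ (Metric.sphere_subset_closedBall hζ), hM ζ hζ⟩)
  obtain ⟨δ₂, hδ₂, hδ₂M'⟩ := Metric.eventually_nhds_iff.1 hM'
  obtain ⟨δ, hδ, hδ1, hδ2, hδρ⟩ : ∃ δ > 0, δ ≤ δ₁ ∧ δ ≤ δ₂ ∧ δ ≤ ρ / 2 :=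
    ⟨min δ₁ (min δ₂ (ρ / 2)), by positivity, min_le_left _ _,
      (min_le_right _ _).trans (min_le_left _ _), (min_le_right _ _).trans (min_le_right _ _)⟩
  have hnear : ∀ x ∈ L, ∀ y, dist y x ≤ ρ → y ∈ K := fun x hx y hy =>
    Metric.mem_cthickening_of_dist_le y x ρ L hx hy
  obtain ⟨h, hh, hup, hlow, hhsub⟩ := exists_contDiff_regularization hgm hgB hsub hδ
  have hfc : Continuous fun ζ => h (ψ ζ) := hh.continuous.comp hψ.continuous
  have havg : Real.circleAverage (fun ζ => h (ψ ζ)) c r ≤ M := by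
    refine Real.circleAverage_mono_on_of_le_circle (hfc.continuousOn.circleIntegrable hr.le)
      fun ζ hζ => hup _ _ fun y hy => ?_
    rw [abs_of_pos hr] at hζ
    have h1 : y ∈ {z | z ∈ Ω ∧ u z < M} :=
      hδ₁V (Metric.mem_thickening_iff.2 ⟨_, mem_image_of_mem _ hζ, hy.trans_le hδ1⟩)
    have h2 : G y ≤ M := by
      by_cases hyK : y ∈ K
      · rw [hGK y hyK]
        exact max_le h1.2.le le_rfl
      · simp [hG, hyK]
    rw [← hgG] at h2
    exact_mod_cast h2
  -- `h` averages over a ball, so the lower bound on `u` is needed on a whole neighborhood of the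
  -- centre.
  have hcen : M' ≤ h (ψ c) := by
    refine hlow _ _ fun y hy => ?_
    have hy' : dist y (ψ c) < δ := hy
    have hyK : y ∈ K := hnear _ hcL y (by linarith)
    have h1 : (M' : EReal) ≤ G y := by
      rw [hGK y hyK]
      exact (hδ₂M' (hy'.trans_le hδ2)).trans (le_max_left _ _)
    rw [← hgG] at h1
    exact_mod_cast h1
  obtain ⟨ζ₀, hζ₀, Q, hQ, hQ0, ε, hε, htouch⟩ := exists_touching_of_circleAverage_lt hr
    hfc.continuousOn (havg.trans_lt (hMM'.trans_le hcen))
  have hζ₀L : ψ ζ₀ ∈ L := mem_image_of_mem _ (Metric.ball_subset_closedBall hζ₀)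
  refine not_touching_of_submean hψ (hh.contDiffAt.hasStrictFDerivAt one_ne_zero) hh.continuous
    hQ hQ0 hε (Filter.mem_of_superset (Metric.isOpen_ball.mem_nhds hζ₀) fun ζ hζ =>
      htouch ζ (Metric.ball_subset_closedBall hζ)) ?_
  -- The translation by `y` and the tangent disc each use at most `ρ / 2`, so the shifted disc stays
  -- in `K`.
  have hsmall : ∀ᶠ s in 𝓝[>] (0 : ℝ), s * ‖deriv ψ ζ₀‖ < ρ / 2 := by
    have h1 : Tendsto (fun s : ℝ => s * ‖deriv ψ ζ₀‖) (𝓝 0) (𝓝 (0 * ‖deriv ψ ζ₀‖)) :=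
      (continuous_id.mul continuous_const).tendsto 0
    rw [zero_mul] at h1
    exact (h1.eventually (eventually_lt_nhds (by positivity))).filter_mono nhdsWithin_le_nhds
  filter_upwards [hsmall, self_mem_nhdsWithin] with s hs hs0
  have h1 := hhsub (ψ ζ₀) (deriv ψ ζ₀) s hs0 fun ζ hζ y hy => hnear _ hζ₀L _ ?_
  · rw [← Real.circleAverage_map_add_const]
    simpa using h1
  · rw [mem_closedBall_zero_iff] at hζ
    rw [mem_ball_zero_iff] at hy
    rw [dist_eq_norm, show ψ ζ₀ - y + ζ • deriv ψ ζ₀ - ψ ζ₀ = ζ • deriv ψ ζ₀ - y by abel]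
    have h2 := norm_sub_le (ζ • deriv ψ ζ₀) y
    have h3 : ‖ζ • deriv ψ ζ₀‖ ≤ s * ‖deriv ψ ζ₀‖ := by
      rw [norm_smul]
      gcongr
    linarith

/-! ### The boundary distance along complex discs -/

/-- If `D` locally admits plurisubharmonic functions tending to `∞` at the boundary points, then
`-log` of the boundary distance has the sub-mean value property on complex discs. -/
theorem neg_log_infDist_le_circleAverage {n : ℕ} {D : Set (EuclideanSpace ℂ (Fin n))}
    (hD : IsOpen D) (hDc : Dᶜ.Nonempty)
    (hloc : ∀ a ∈ frontier D, ∃ U : Set (EuclideanSpace ℂ (Fin n)), IsOpen U ∧ a ∈ U ∧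
      ∃ u : EuclideanSpace ℂ (Fin n) → EReal,
        IsPlurisubharmonicOn u (D ∩ U) ∧ Tendsto u (𝓝[D ∩ U] a) (𝓝 ⊤))
    (z w : EuclideanSpace ℂ (Fin n)) {c : ℂ} {r : ℝ} (hr : 0 < r)
    (hdisc : ∀ ζ ∈ Metric.closedBall c r, z + ζ • w ∈ D) :
    -Real.log (Metric.infDist (z + c • w) Dᶜ) ≤
      Real.circleAverage (fun ζ => -Real.log (Metric.infDist (z + ζ • w) Dᶜ)) c r := by
  by_contra! hlt
  set d : ℂ → ℝ := fun ζ => Metric.infDist (z + ζ • w) Dᶜ with hd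
  have hdpos : ∀ ζ ∈ Metric.closedBall c r, 0 < d ζ := fun ζ hζ =>
    (hD.isClosed_compl.notMem_iff_infDist_pos hDc).1 fun h => h (hdisc ζ hζ)
  have hdc : Continuous d := (Metric.continuous_infDist_pt _).comp (by fun_prop)
  obtain ⟨ζ₀, hζ₀, Q, hQ, hQ0, ε, hε, htouch⟩ :=
    exists_touching_of_circleAverage_lt (f := fun ζ => -Real.log (d ζ)) hr
      (hdc.continuousOn.log fun ζ hζ => (hdpos ζ hζ).ne').neg hlt
  have hζ₀' := Metric.ball_subset_closedBall hζ₀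
  obtain ⟨a, haD, ha⟩ := hD.isClosed_compl.exists_infDist_eq_dist hDc (z + ζ₀ • w)
  have hd0 : d ζ₀ = ‖a - (z + ζ₀ • w)‖ := by rw [← dist_eq_norm, dist_comm]; exact ha
  set Φ : ℝ × ℂ → EuclideanSpace ℂ (Fin n) := fun p =>
    z + p.2 • w + ((p.1 : ℂ) * Complex.exp (-Q p.2)) • (a - (z + ζ₀ • w)) with hΦ
  have hΦc : Continuous Φ := by
    have := hQ.continuous
    fun_prop
  have hΦa : Φ (1, ζ₀) = a := by simp [hΦ, hQ0]
  have hΦD : ∀ t ζ, 0 ≤ t → t ≤ 1 → ζ ∈ Metric.closedBall c r → (t < 1 ∨ ζ ≠ ζ₀) →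
      Φ (t, ζ) ∈ D := by
    intro t ζ ht0 ht1 hζ hor
    -- This is the touching inequality, exponentiated: the distance to the complement exceeds the
    -- length of the push by the factor `e^{ε‖ζ - ζ₀‖²}`.
    have h1 : d ζ₀ * (Real.exp (-(Q ζ).re) * Real.exp (ε * ‖ζ - ζ₀‖ ^ 2)) ≤ d ζ := by
      have h2 := htouch ζ hζ
      rw [← Real.log_le_log_iff (mul_pos (hdpos ζ₀ hζ₀') (by positivity)) (hdpos ζ hζ),
        Real.log_mul (hdpos ζ₀ hζ₀').ne' (by positivity), ← Real.exp_add, Real.log_exp]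
      linarith
    have h2 : dist (z + ζ • w) (Φ (t, ζ)) = t * Real.exp (-(Q ζ).re) * d ζ₀ := by
      rw [dist_comm, dist_eq_norm, hd0]
      simp only [hΦ, add_sub_cancel_left]
      rw [norm_smul, norm_mul, Complex.norm_exp, Complex.norm_real, Real.norm_of_nonneg ht0,
        Complex.neg_re]
    have h3 : t < Real.exp (ε * ‖ζ - ζ₀‖ ^ 2) := by
      rcases hor with h | h
      · exact h.trans_le (Real.one_le_exp (by positivity))
      · refine ht1.trans_lt (Real.one_lt_exp_iff.2 ?_)
        have := norm_pos_iff.2 (sub_ne_zero.2 h)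
        positivity
    by_contra hmem
    refine Metric.notMem_of_dist_lt_infDist (s := Dᶜ) (x := z + ζ • w) ?_ hmem
    rw [h2]
    refine lt_of_lt_of_le ?_ h1
    have h4 : 0 < Real.exp (-(Q ζ).re) * d ζ₀ := mul_pos (Real.exp_pos _) (hdpos ζ₀ hζ₀')
    nlinarith [mul_lt_mul_of_pos_right h3 h4]
  have hpath : Tendsto (fun t : ℝ => Φ (t, ζ₀)) (𝓝[<] 1) (𝓝 a) := by
    rw [← hΦa]
    exact ((hΦc.comp (by fun_prop : Continuous fun t : ℝ => (t, ζ₀))).tendsto 1).mono_left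
      nhdsWithin_le_nhds
  have hpos : ∀ᶠ t : ℝ in 𝓝[<] 1, 0 ≤ t :=
    ((eventually_gt_nhds one_pos).filter_mono nhdsWithin_le_nhds).mono fun t ht => ht.le
  have hpathD : ∀ᶠ t : ℝ in 𝓝[<] 1, Φ (t, ζ₀) ∈ D := by
    filter_upwards [self_mem_nhdsWithin, hpos] with t ht ht0
    exact hΦD t ζ₀ ht0 (le_of_lt ht) hζ₀' (Or.inl ht)
  have hafr : a ∈ frontier D := by
    rw [hD.frontier_eq]
    exact ⟨mem_closure_of_tendsto hpath hpathD, haD⟩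
  obtain ⟨U, hU, haU, u, hu, hulim⟩ := hloc a hafr
  have hDU : IsOpen (D ∩ U) := hD.inter hU
  obtain ⟨η, hη, hηU⟩ : ∃ η > 0, ∀ p : ℝ × ℂ, dist p (1, ζ₀) < η → Φ p ∈ U :=
    Metric.eventually_nhds_iff.1
      (hΦc.continuousAt.eventually_mem (by rw [hΦa]; exact hU.mem_nhds haU))
  obtain ⟨r₁, hr₁, hr₁η, hr₁c⟩ : ∃ r₁ > 0, r₁ < η ∧ Metric.closedBall ζ₀ r₁ ⊆
      Metric.closedBall c r := by
    obtain ⟨s, hs, hsub⟩ := Metric.isOpen_iff.1 Metric.isOpen_ball ζ₀ hζ₀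
    refine ⟨min (s / 2) (η / 2), by positivity, ?_, ?_⟩
    · exact (min_le_right _ _).trans_lt (by linarith)
    · exact ((Metric.closedBall_subset_ball ((min_le_left _ _).trans_lt (by linarith))).trans
        hsub).trans Metric.ball_subset_closedBall
  obtain ⟨t₁, ht₁0, ht₁1, ht₁η⟩ : ∃ t₁ : ℝ, 0 ≤ t₁ ∧ t₁ < 1 ∧ 1 - t₁ < η :=
    ⟨max 0 (1 - η / 2), le_max_left _ _, max_lt one_pos (by linarith), by
      have := le_max_right 0 (1 - η / 2)
      linarith⟩
  have hΦU : ∀ t ζ, t₁ ≤ t → t ≤ 1 → ζ ∈ Metric.closedBall ζ₀ r₁ → Φ (t, ζ) ∈ U := by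
    intro t ζ ht ht' hζ
    refine hηU _ ?_
    rw [Prod.dist_eq]
    refine max_lt ?_ ((Metric.mem_closedBall.1 hζ).trans_lt hr₁η)
    rw [Real.dist_eq, abs_sub_comm, abs_of_nonneg (sub_nonneg.2 ht')]
    linarith
  -- The value `t = 1` may be included because the circle avoids `ζ₀`; this makes the bound uniform
  -- as `t → 1`.
  obtain ⟨M, hM⟩ : ∃ M : ℝ, ∀ t ∈ Icc t₁ 1, ∀ ζ ∈ Metric.sphere ζ₀ r₁, u (Φ (t, ζ)) < M := by
    set C := Φ '' (Icc t₁ 1 ×ˢ Metric.sphere ζ₀ r₁) with hC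
    have hCc : IsCompact C := (isCompact_Icc.prod (isCompact_sphere ζ₀ r₁)).image hΦc
    have hCD : C ⊆ D ∩ U := by
      rintro _ ⟨⟨t, ζ⟩, ⟨ht, hζ⟩, rfl⟩
      have hζ' := Metric.sphere_subset_closedBall hζ
      exact ⟨hΦD t ζ (ht₁0.trans ht.1) ht.2 (hr₁c hζ')
        (Or.inr (Metric.ne_of_mem_sphere hζ hr₁.ne')), hΦU t ζ ht.1 ht.2 hζ'⟩
    have hmem : ∀ t ∈ Icc t₁ 1, ∀ ζ ∈ Metric.sphere ζ₀ r₁, Φ (t, ζ) ∈ C := fun t ht ζ hζ =>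
      mem_image_of_mem Φ (mk_mem_prod ht hζ)
    rcases C.eq_empty_or_nonempty with hCe | hCne
    · refine ⟨0, fun t ht ζ hζ => ?_⟩
      have := hmem t ht ζ hζ
      rw [hCe] at this
      exact this.elim
    · obtain ⟨y, hy, hymax⟩ := (hu.upperSemicontinuousOn.mono hCD).exists_isMaxOn hCne hCc
      obtain ⟨M, hM, -⟩ := EReal.lt_iff_exists_real_btwn.1 (hu.lt_top y (hCD hy))
      exact ⟨M, fun t ht ζ hζ => (hymax (hmem t ht ζ hζ)).trans_lt hM⟩
  have hbig : ∀ᶠ y in 𝓝[D ∩ U] a, ((M + 1 : ℝ) : EReal) ≤ u y :=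
    (hulim.eventually (eventually_gt_nhds (EReal.coe_lt_top _))).mono fun y hy => le_of_lt hy
  have hpathDU : Tendsto (fun t : ℝ => Φ (t, ζ₀)) (𝓝[<] 1) (𝓝[D ∩ U] a) :=
    tendsto_nhdsWithin_iff.2 ⟨hpath, hpathD.and (hpath.eventually (hU.mem_nhds haU))⟩
  -- The lower bound on `u` must hold near `Φ (t, ζ₀)`, not just at it, hence the iterated
  -- `eventually`.
  obtain ⟨t, ht, htDU, ht1 : t < 1, htt₁⟩ :=
    ((hpathDU.eventually (eventually_eventually_nhdsWithin.2 hbig)).and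
      ((hpathDU.eventually eventually_mem_nhdsWithin).and (eventually_mem_nhdsWithin.and
        ((eventually_gt_nhds ht₁1).filter_mono nhdsWithin_le_nhds)))).exists
  rw [hDU.nhdsWithin_eq htDU] at ht
  have hψ : Differentiable ℂ fun ζ => Φ (t, ζ) := by
    simp only [hΦ]
    fun_prop
  exact hu.not_lt_on_disc hDU hψ hr₁
    (fun ζ hζ => ⟨hΦD t ζ (ht₁0.trans (le_of_lt htt₁)) ht1.le (hr₁c hζ) (Or.inl ht1),
      hΦU t ζ (le_of_lt htt₁) ht1.le hζ⟩)
    (lt_add_one M) (fun ζ hζ => hM t ⟨le_of_lt htt₁, ht1.le⟩ ζ hζ) ht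

/-! ### The exhaustion function -/

theorem norm_le_circleAverage_norm {n : ℕ} (z w : EuclideanSpace ℂ (Fin n)) (c : ℂ) (r : ℝ) :
    ‖z + c • w‖ ≤ Real.circleAverage (fun ζ => ‖z + ζ • w‖) c r := by
  have hd : Differentiable ℂ fun ζ : ℂ => z + ζ • w := by fun_prop
  have h1 : Real.circleAverage (fun ζ => z + ζ • w) c r = z + c • w := hd.diffContOnCl.circleAverage
  rw [← h1, Real.circleAverage_def, Real.circleAverage_def, norm_smul, Real.norm_of_nonneg
    (by positivity), smul_eq_mul]
  exact mul_le_mul_of_nonneg_left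
    (intervalIntegral.norm_integral_le_integral_norm Real.two_pi_pos.le) (by positivity)

/-- A proper open set on which `-log` of the boundary distance has the sub-mean value property is
pseudoconvex. -/
theorem isPseudoconvex_of_neg_log_infDist {n : ℕ} {D : Set (EuclideanSpace ℂ (Fin n))}
    (hD : IsOpen D) (hDc : Dᶜ.Nonempty)
    (hsub : ∀ (z w : EuclideanSpace ℂ (Fin n)) (c : ℂ) (r : ℝ), 0 < r →
      (∀ ζ ∈ Metric.closedBall c r, z + ζ • w ∈ D) →
      -Real.log (Metric.infDist (z + c • w) Dᶜ) ≤
        Real.circleAverage (fun ζ => -Real.log (Metric.infDist (z + ζ • w) Dᶜ)) c r) :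
    IsPseudoconvex D := by
  have hpos : ∀ z ∈ D, 0 < Metric.infDist z Dᶜ := fun z hz =>
    (hD.isClosed_compl.notMem_iff_infDist_pos hDc).1 fun h => h hz
  have hlog : ContinuousOn (fun z => -Real.log (Metric.infDist z Dᶜ)) D :=
    ((Metric.continuous_infDist_pt _).continuousOn.log fun z hz => (hpos z hz).ne').neg
  have hcont : ContinuousOn (fun z => max (-Real.log (Metric.infDist z Dᶜ)) ‖z‖) D :=
    hlog.sup continuous_norm.continuousOn
  refine ⟨_, hcont, isPlurisubharmonicOn_coe hcont fun z w c r hr hdisc => ?_, fun t => ?_⟩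
  · have hline : ContinuousOn (fun ζ : ℂ => z + ζ • w) (Metric.sphere c r) := by fun_prop
    have hmaps : MapsTo (fun ζ : ℂ => z + ζ • w) (Metric.sphere c r) D := fun ζ hζ =>
      hdisc ζ (Metric.sphere_subset_closedBall hζ)
    have hi := (hcont.comp hline hmaps).circleIntegrable hr.le
    refine max_le ((hsub z w c r hr hdisc).trans ?_) ((norm_le_circleAverage_norm z w c r).trans ?_)
    · exact Real.circleAverage_mono ((hlog.comp hline hmaps).circleIntegrable hr.le) hi
        fun ζ _ => le_max_left _ _
    · exact Real.circleAverage_mono (hline.norm.circleIntegrable hr.le) hi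
        fun ζ _ => le_max_right _ _
  -- Points off `D` have `infDist` equal to `0 < exp (-t)`, so the right-hand side needs no separate
  -- membership condition and is visibly closed.
  · have heq : {z | z ∈ D ∧ max (-Real.log (Metric.infDist z Dᶜ)) ‖z‖ ≤ t} =
        Metric.closedBall 0 t ∩ {z | Real.exp (-t) ≤ Metric.infDist z Dᶜ} := by
      ext z
      simp only [mem_ofPred_eq, mem_inter_iff, mem_closedBall_zero_iff, max_le_iff]
      constructor
      · rintro ⟨hz, h1, h2⟩
        exact ⟨h2, (Real.le_log_iff_exp_le (hpos z hz)).1 (by linarith)⟩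
      · rintro ⟨h2, h1⟩
        have h3 : 0 < Metric.infDist z Dᶜ := (Real.exp_pos _).trans_le h1
        have hz : z ∈ D := by
          by_contra h
          exact h3.ne' (Metric.infDist_zero_of_mem h)
        exact ⟨hz, by linarith [(Real.le_log_iff_exp_le h3).2 h1], h2⟩
    rw [heq]
    exact (isCompact_closedBall 0 t).inter_right
      (isClosed_le continuous_const (Metric.continuous_infDist_pt _))

theorem isPseudoconvex_univ {n : ℕ} : IsPseudoconvex (univ : Set (EuclideanSpace ℂ (Fin n))) := by
  refine ⟨fun z => ‖z‖, continuous_norm.continuousOn, isPlurisubharmonicOn_coe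
    continuous_norm.continuousOn fun z w c r _ _ => norm_le_circleAverage_norm z w c r, fun t => ?_⟩
  have h : {z : EuclideanSpace ℂ (Fin n) | z ∈ univ ∧ ‖z‖ ≤ t} = Metric.closedBall 0 t := by
    ext z
    simp
  exact h ▸ isCompact_closedBall 0 t

/-! ### Local functions from complex hyperplanes, and the conclusion -/

/-- The negative logarithm of the modulus of a zero-free affine function is plurisubharmonic. -/
theorem isPlurisubharmonicOn_neg_log_norm {n : ℕ} (ℓ : EuclideanSpace ℂ (Fin n) →ₗ[ℂ] ℂ)
    (a : EuclideanSpace ℂ (Fin n)) {Ω : Set (EuclideanSpace ℂ (Fin n))}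
    (h0 : ∀ z ∈ Ω, ℓ (z - a) ≠ 0) :
    IsPlurisubharmonicOn (fun z => ((-Real.log ‖ℓ (z - a)‖ : ℝ) : EReal)) Ω := by
  have hℓ : Continuous ℓ := ℓ.continuous_of_finiteDimensional
  refine isPlurisubharmonicOn_coe ?_ fun z w c r hr hdisc => ?_
  · exact (ContinuousOn.log (by fun_prop) fun z hz => norm_ne_zero_iff.2 (h0 z hz)).neg
  · have hd : Differentiable ℂ fun ζ : ℂ => ℓ (z + ζ • w - a) := by
      have : (fun ζ : ℂ => ℓ (z + ζ • w - a)) = fun ζ => ℓ (z - a) + ζ * ℓ w := by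
        ext ζ
        rw [add_sub_right_comm, map_add, map_smul, smul_eq_mul]
      rw [this]
      fun_prop
    have hm : Real.circleAverage (fun ζ => Real.log ‖ℓ (z + ζ • w - a)‖) c r =
        Real.log ‖ℓ (z + c • w - a)‖ := by
      refine InnerProductSpace.HarmonicOnNhd.circleAverage_eq fun ζ hζ => ?_
      rw [abs_of_pos hr] at hζ
      exact (hd.analyticAt ζ).harmonicAt_log_norm (h0 _ (hdisc ζ hζ))
    have hn : Real.circleAverage (fun ζ => -Real.log ‖ℓ (z + ζ • w - a)‖) c r =
        -Real.circleAverage (fun ζ => Real.log ‖ℓ (z + ζ • w - a)‖) c r := by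
      rw [Real.circleAverage_def, Real.circleAverage_def, intervalIntegral.integral_neg, smul_neg]
    rw [hn, hm]

theorem tendsto_neg_log_norm_nhdsWithin {n : ℕ} (ℓ : EuclideanSpace ℂ (Fin n) →ₗ[ℂ] ℂ)
    (a : EuclideanSpace ℂ (Fin n)) {Ω : Set (EuclideanSpace ℂ (Fin n))}
    (h0 : ∀ z ∈ Ω, ℓ (z - a) ≠ 0) :
    Tendsto (fun z => ((-Real.log ‖ℓ (z - a)‖ : ℝ) : EReal)) (𝓝[Ω] a) (𝓝 ⊤) := by
  have hℓ : Continuous ℓ := ℓ.continuous_of_finiteDimensional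
  refine EReal.tendsto_coe_nhds_top_iff.2 (tendsto_neg_atBot_atTop.comp ?_)
  refine Real.tendsto_log_nhdsGT_zero.comp (tendsto_nhdsWithin_iff.2 ⟨?_, ?_⟩)
  · have h1 : Continuous fun z => ‖ℓ (z - a)‖ := by fun_prop
    have h2 := h1.tendsto a
    simp only [sub_self, map_zero, norm_zero] at h2
    exact h2.mono_left nhdsWithin_le_nhds
  · filter_upwards [self_mem_nhdsWithin] with z hz
    exact norm_pos_iff.2 (h0 z hz)

theorem proposition3 (n : ℕ) (D : Set (EuclideanSpace ℂ (Fin n)))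
    (hD_open : IsOpen D) (hD_conn : IsConnected D) :
    ((∀ a ∈ frontier D, ∃ U : Set (EuclideanSpace ℂ (Fin n)), IsOpen U ∧ a ∈ U ∧
        ∃ u : EuclideanSpace ℂ (Fin n) → EReal,
          IsPlurisubharmonicOn u (D ∩ U) ∧ Tendsto u (𝓝[D ∩ U] a) (𝓝 ⊤)) →
      IsPseudoconvex D) ∧
    (IsLocallyWeaklyLinearlyConvex D → IsPseudoconvex D) := by
  have main : (∀ a ∈ frontier D, ∃ U : Set (EuclideanSpace ℂ (Fin n)), IsOpen U ∧ a ∈ U ∧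
        ∃ u : EuclideanSpace ℂ (Fin n) → EReal,
          IsPlurisubharmonicOn u (D ∩ U) ∧ Tendsto u (𝓝[D ∩ U] a) (𝓝 ⊤)) →
      IsPseudoconvex D := by
    intro hloc
    -- For an empty complement `infDist` is the default `0`, and the norm alone is an exhaustion.
    rcases Dᶜ.eq_empty_or_nonempty with hDc | hDc
    · rw [compl_empty_iff.1 hDc]
      exact isPseudoconvex_univ
    · exact isPseudoconvex_of_neg_log_infDist hD_open hDc fun z w c r hr hdisc =>
        neg_log_infDist_le_circleAverage hD_open hDc hloc z w hr hdisc
  refine ⟨main, fun hconv => main fun a ha => ?_⟩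
  obtain ⟨ℓ, -, V, hV, hVD⟩ := hconv a ha
  obtain ⟨U, hUV, hU, haU⟩ := mem_nhds_iff.1 hV
  have h0 : ∀ z ∈ D ∩ U, ℓ (z - a) ≠ 0 := fun z hz hℓ => by
    have : z ∈ {z | ℓ (z - a) = 0} ∩ D ∩ V := ⟨⟨hℓ, hz.1⟩, hUV hz.2⟩
    rw [hVD] at this
    exact this
  exact ⟨U, hU, haU, _, isPlurisubharmonicOn_neg_log_norm ℓ a h0,
    tendsto_neg_log_norm_nhdsWithin ℓ a h0⟩
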